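/- Graphs are in the sense of Serre: every edge $e$ from $\alpha(e)$ to $\omega(e)$ has an inverse edge $e^{-1}\neq e$ from $\omega(e)$ to $\alpha(e)$, with $(e^{-1})^{-1}=e$. Graph morphisms preserve incidence and inverses. A morphism is an immersion (resp. a cover) if for each vertex it is injective (resp. bijective) on the star of edges starting at that vertex. A deck transformation of an immersion $f:\tilde\Gamma\to\Gamma$ is an automorphism $\gamma$ of $\tilde\Gamma$ with $f\circ\gamma=f$. A cover is normal if any two vertices of $\tilde\Gamma$ with the same image are related by a deck transformation. A cover $f:\tilde\Gamma\to\Gamma$ of connected graphs is the universal cover if $f(\pi_1(\tilde\Gamma,\tilde v))$ is the trivial subgroup of $\pi_1(\Gamma,f(\tilde v))$ for every vertex $\tilde v$. Here $\pi_1$ consists of circuits at a vertex modulo insertion and deletion of subpaths $ee^{-1}$. For a graph $\Gamma$, let $\sim_i$ be the congruence on the free category of paths (empty paths included) generated by $p\sim_i pp^{-1}p$ for all paths $p$ and $pp^{-1}qq^{-1}\sim_i qq^{-1}pp^{-1}$ for all paths $p,q$ with the same initial vertex. The loop monoid $L(\Gamma,v)$ is the inverse monoid of $\sim_i$-classes of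 circuits of $\Gamma$ based at $v$. A morphism $f$ induces homomorphisms $L(\tilde\Gamma,\tilde v)\to L(\Gamma,f(\tilde v))$. A submonoid of an inverse monoid is a full inverse submonoid if it is closed under inverses and contains all idempotents. For a submonoid $H$ of $L(\Gamma,v)$ let $N(H,v)=\{p\in L(\Gamma,v): pHp^{-1}\subseteq H,\ p^{-1}Hp\subseteq H\}$. **Theorem.** Let $f:\tilde\Gamma\to\Gamma$ be an immersion of connected graphs, let $\tilde v_0$ be a vertex of $\tilde\Gamma$, $v_0=f(\tilde v_0)$, and $H=f(L(\tilde\Gamma,\tilde v_0))\subseteq L(\Gamma,v_0)$. Then: (a) $f$ is a cover if and only if $H$ is a full inverse submonoid of $L(\Gamma,v_0)$. (b) $f$ is a normal cover if and only if $N(H,v_0)=L(\Gamma,v_0)$. (c) $f$ is the universal cover of $\Gamma$ if and only if $H$ is exactly the set of idempotents of $L(\Gamma,v_0)$. Moreover, suppose the edges of $\Gamma$ are labelled over $X\cup X^{-1}$ for some set $X$, so that inverse edges have inverse labels and distinct edges with the same initial vertex have distinct labels. Then the set of idempotents of $L(\Gamma,v_0)$ equals $\{p\in L(\Gamma,v_0):\ell(p)\text{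 is a Dyck word}\}$, where $\ell(p)$ is the label of $p$ and a Dyck word is a word whose reduced form in the free group on $X$ is $1$. -/

import Mathlib

open Quiver

universe u v u' v' w

/-! ### Inverse monoids -/

/-- An inverse monoid: every `a` has exactly one `b` with `a b a = a` and `b a b = b`,
namely `b = a⁻¹`. -/
class InverseMonoid (M : Type u) extends Monoid M, Inv M where
  mul_inv_mul : ∀ a : M, a * a⁻¹ * a = a
  inv_mul_inv : ∀ a : M, a⁻¹ * a * a⁻¹ = a⁻¹
  eq_inv_of_mul : ∀ a b : M, a * b * a = a → b * a * b = b → b = a⁻¹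

namespace InverseMonoid

variable {M : Type u} [InverseMonoid M]

/-- The set `E(M)` of idempotents. -/
def idempotents (M : Type u) [InverseMonoid M] : Set M := {e | e * e = e}

/-- `H` is a full inverse submonoid of `M`: a submonoid closed under inversion that contains
all idempotents of `M`. -/
def IsFull (H : Submonoid M) : Prop :=
  (∀ a ∈ H, a⁻¹ ∈ H) ∧ idempotents M ⊆ (H : Set M)

/-- The normalizer `N(H) = {a ∈ M : a H a⁻¹ ⊆ H and a⁻¹ H a ⊆ H}`. -/
def normalizer (H : Submonoid M) : Set M :=
  {a | (∀ h ∈ H, a * h * a⁻¹ ∈ H) ∧ (∀ h ∈ H, a⁻¹ * h * a ∈ H)}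

end InverseMonoid

/-! ### Graphs in the sense of Serre, immersions, covers, deck transformations

A graph is a quiver with an involution `e ↦ reverse e` on its edges that swaps the endpoints and
has no fixed edge. -/

/-- No edge equals its inverse edge (only a loop could). -/
class IsSerreGraph (V : Type u) [Quiver.{v} V] [HasInvolutiveReverse V] : Prop where
  reverse_ne : ∀ {a : V} (e : a ⟶ a), reverse e ≠ e

section Morphisms

variable {U : Type u} [Quiver.{v} U] [HasInvolutiveReverse U]
variable {V : Type u'} [Quiver.{v'} V] [HasInvolutiveReverse V]

/-- A graph morphism is an immersion if it is injective on each star. -/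
def IsImmersion (f : U ⥤q V) : Prop := ∀ x : U, Function.Injective (f.star x)

/-- A graph morphism is a cover if it is bijective on each star. -/
def IsCover (f : U ⥤q V) : Prop := ∀ x : U, Function.Bijective (f.star x)

/-- A deck transformation of `f : U → V`: a graph automorphism `γ` of `U` with `f ∘ γ = f`
(on vertices and edges). -/
structure DeckTransformation (f : U ⥤q V) where
  hom : U ⥤q U
  inv : U ⥤q U
  hom_inv : hom ⋙q inv = 𝟭q U
  inv_hom : inv ⋙q hom = 𝟭q U
  map_reverse : hom.MapReverse
  comp_eq : hom ⋙q f = f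

/-- A cover is normal if the deck transformations act transitively on each vertex fibre. -/
def IsNormalCover (f : U ⥤q V) : Prop :=
  IsCover f ∧ ∀ x y : U, f.obj x = f.obj y → ∃ γ : DeckTransformation f, γ.hom.obj x = y

theorem mapPath_reverse (f : U ⥤q V) [f.MapReverse] {a b : U} (p : Path a b) :
    f.mapPath p.reverse = (f.mapPath p).reverse := by
  induction p with
  | nil => rfl
  | cons p e ih =>
    simp only [Path.reverse, Prefunctor.mapPath_comp, Prefunctor.mapPath_toPath,
      Prefunctor.map_reverse, ih, Prefunctor.mapPath_cons]

end Morphisms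

/-! ### The free inverse category and its loop monoids -/

section InverseEquiv

variable {V : Type u} [Quiver.{v} V] [HasInvolutiveReverse V]

/-- The congruence `∼ᵢ` on the free category of a graph generated by `p = p p⁻¹ p` and
`p p⁻¹ q q⁻¹ = q q⁻¹ p p⁻¹` for paths `p`, `q` with the same initial vertex. The quotient of the
free category by it is the free inverse category. -/
inductive InvEquiv : ∀ {a b : V}, Path a b → Path a b → Prop
  | refl {a b : V} (p : Path a b) : InvEquiv p p
  | symm {a b : V} {p q : Path a b} : InvEquiv p q → InvEquiv q p
  | trans {a b : V} {p q r : Path a b} : InvEquiv p q → InvEquiv q r → InvEquiv p r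
  | comp {a b c : V} {p p' : Path a b} {q q' : Path b c} :
      InvEquiv p p' → InvEquiv q q' → InvEquiv (p.comp q) (p'.comp q')
  | regular {a b : V} (p : Path a b) : InvEquiv p ((p.comp p.reverse).comp p)
  | commute {a b c : V} (p : Path a b) (q : Path a c) :
      InvEquiv ((p.comp p.reverse).comp (q.comp q.reverse))
        ((q.comp q.reverse).comp (p.comp p.reverse))

theorem InvEquiv.reverse {a b : V} {p q : Path a b} (h : InvEquiv p q) :
    InvEquiv p.reverse q.reverse := by
  induction h with
  | refl p => exact .refl _
  | symm _ ih => exact ih.symm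
  | trans _ _ ih₁ ih₂ => exact ih₁.trans ih₂
  | comp _ _ ih₁ ih₂ => simpa only [Path.reverse_comp] using ih₂.comp ih₁
  | regular p =>
    simpa only [Path.reverse_comp, Path.reverse_reverse, Path.comp_assoc] using
      InvEquiv.regular p.reverse
  | commute p q =>
    simpa only [Path.reverse_comp, Path.reverse_reverse] using InvEquiv.commute q p

/-- `∼ᵢ` on the circuits based at `x`. -/
def loopSetoid (x : V) : Setoid (Path x x) where
  r := InvEquiv
  iseqv := ⟨.refl, .symm, .trans⟩

/-- The loop monoid `L(Γ, x)`: the circuits of the graph based at `x`, modulo `∼ᵢ`. -/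
def LoopMonoid (x : V) : Type (max u v) := Quotient (loopSetoid x)

namespace LoopMonoid

variable {x : V}

/-- The class `[[p]]` of a circuit. -/
def mk (p : Path x x) : LoopMonoid x := Quotient.mk (loopSetoid x) p

theorem sound {p q : Path x x} (h : InvEquiv p q) : mk p = mk q := Quotient.sound h

instance : Monoid (LoopMonoid x) where
  one := mk Path.nil
  mul a b := Quotient.liftOn₂ a b (fun p q => mk (p.comp q))
    (fun _ _ _ _ h₁ h₂ => sound (InvEquiv.comp h₁ h₂))
  mul_assoc := by
    rintro ⟨p⟩ ⟨q⟩ ⟨r⟩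
    exact congrArg mk (Path.comp_assoc p q r)
  one_mul := by
    rintro ⟨p⟩
    exact congrArg mk (Path.nil_comp p)
  mul_one := by
    rintro ⟨p⟩
    exact congrArg mk (Path.comp_nil p)

instance : Inv (LoopMonoid x) where
  inv a := Quotient.liftOn a (fun p => mk p.reverse) (fun _ _ h => sound (InvEquiv.reverse h))

theorem mk_mul (p q : Path x x) : mk p * mk q = mk (p.comp q) := rfl

theorem mk_inv (p : Path x x) : (mk p)⁻¹ = mk p.reverse := rfl

theorem mul_inv_mul (a : LoopMonoid x) : a * a⁻¹ * a = a := by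
  obtain ⟨p⟩ := a
  exact sound (InvEquiv.regular p).symm

theorem inv_inv' (a : LoopMonoid x) : a⁻¹⁻¹ = a := by
  obtain ⟨p⟩ := a
  exact congrArg mk (Path.reverse_reverse p)

theorem inv_mul_inv (a : LoopMonoid x) : a⁻¹ * a * a⁻¹ = a⁻¹ := by
  simpa only [inv_inv'] using mul_inv_mul a⁻¹

theorem mul_inv_comm (a b : LoopMonoid x) :
    (a * a⁻¹) * (b * b⁻¹) = (b * b⁻¹) * (a * a⁻¹) := by
  obtain ⟨p⟩ := a
  obtain ⟨q⟩ := b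
  exact sound (InvEquiv.commute p q)

theorem mul_inv_rev' (a b : LoopMonoid x) : (a * b)⁻¹ = b⁻¹ * a⁻¹ := by
  obtain ⟨p⟩ := a
  obtain ⟨q⟩ := b
  exact congrArg mk (Path.reverse_comp p q)

theorem eq_mul_inv_of_idem {e : LoopMonoid x} (h : e * e = e) : e = e * e⁻¹ := by
  have h' : e⁻¹ * e⁻¹ = e⁻¹ := by rw [← mul_inv_rev', h]
  have h₁ : e * e⁻¹ * (e⁻¹ * e) = e := by
    rw [mul_assoc, ← mul_assoc e⁻¹, h', ← mul_assoc, mul_inv_mul]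
  have h₂ : e⁻¹ * e * (e * e⁻¹) = e⁻¹ := by
    rw [mul_assoc, ← mul_assoc e, h, ← mul_assoc, inv_mul_inv]
  have hc := mul_inv_comm e e⁻¹
  rw [inv_inv', h₁, h₂] at hc
  rw [← hc, h]

theorem idem_comm {e g : LoopMonoid x} (he : e * e = e) (hg : g * g = g) : e * g = g * e := by
  rw [eq_mul_inv_of_idem he, eq_mul_inv_of_idem hg]
  exact mul_inv_comm e g

instance : InverseMonoid (LoopMonoid x) where
  mul_inv_mul := mul_inv_mul
  inv_mul_inv := inv_mul_inv
  eq_inv_of_mul a b h₁ h₂ := by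
    have hab : (a * b) * (a * b) = a * b := by rw [← mul_assoc, h₁]
    have hba : (b * a) * (b * a) = b * a := by rw [← mul_assoc, h₂]
    have hai : (a * a⁻¹) * (a * a⁻¹) = a * a⁻¹ := by rw [← mul_assoc, mul_inv_mul]
    have hia : (a⁻¹ * a) * (a⁻¹ * a) = a⁻¹ * a := by rw [← mul_assoc, inv_mul_inv]
    have e₁ : a * b = a * a⁻¹ := by
      calc a * b = (a * a⁻¹) * (a * b) := by rw [← mul_assoc, mul_inv_mul]
        _ = (a * b) * (a * a⁻¹) := idem_comm hai hab
        _ = a * a⁻¹ := by rw [← mul_assoc, h₁]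
    have e₂ : b * a = a⁻¹ * a := by
      calc b * a = (b * a) * (a⁻¹ * a) := by
            rw [mul_assoc, ← mul_assoc a, mul_inv_mul]
        _ = (a⁻¹ * a) * (b * a) := idem_comm hba hia
        _ = a⁻¹ * a := by rw [mul_assoc, ← mul_assoc a, h₁]
    calc b = b * a * b := h₂.symm
      _ = a⁻¹ * (a * b) := by rw [e₂, mul_assoc]
      _ = a⁻¹ := by rw [e₁, ← mul_assoc, inv_mul_inv]

end LoopMonoid

end InverseEquiv

section LoopMap

variable {U : Type u} [Quiver.{v} U] [HasInvolutiveReverse U]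
variable {V : Type u'} [Quiver.{v'} V] [HasInvolutiveReverse V]

theorem InvEquiv.map (f : U ⥤q V) [f.MapReverse] {a b : U} {p q : Path a b}
    (h : InvEquiv p q) : InvEquiv (f.mapPath p) (f.mapPath q) := by
  induction h with
  | refl p => exact .refl _
  | symm _ ih => exact ih.symm
  | trans _ _ ih₁ ih₂ => exact ih₁.trans ih₂
  | comp _ _ ih₁ ih₂ => simpa only [Prefunctor.mapPath_comp] using ih₁.comp ih₂
  | regular p =>
    simpa only [Prefunctor.mapPath_comp, mapPath_reverse] using InvEquiv.regular (f.mapPath p)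
  | commute p q =>
    simpa only [Prefunctor.mapPath_comp, mapPath_reverse] using
      InvEquiv.commute (f.mapPath p) (f.mapPath q)

/-- The homomorphism `L(U, x) → L(V, f x)`, `[[p]] ↦ [[f p]]`, induced by a graph morphism. -/
def loopMap (f : U ⥤q V) [f.MapReverse] (x : U) : LoopMonoid x →* LoopMonoid (f.obj x) where
  toFun := Quotient.lift (fun p : Path x x => LoopMonoid.mk (f.mapPath p))
    (fun _ _ h => LoopMonoid.sound (InvEquiv.map f h))
  map_one' := rfl
  map_mul' := by
    rintro ⟨p⟩ ⟨q⟩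
    exact congrArg LoopMonoid.mk (Prefunctor.mapPath_comp f p q)

/-- The submonoid `f(L(U, x))` of `L(V, f x)`. -/
def loopImage (f : U ⥤q V) [f.MapReverse] (x : U) : Submonoid (LoopMonoid (f.obj x)) :=
  MonoidHom.mrange (loopMap f x)

end LoopMap

/-! ### The fundamental group and the universal cover -/

section Fundamental

variable {V : Type u} [Quiver.{v} V] [HasInvolutiveReverse V]

/-- Homotopy of paths: insertion and deletion of subpaths `e e⁻¹`. -/
inductive PathHomotopic : ∀ {a b : V}, Path a b → Path a b → Prop
  | refl {a b : V} (p : Path a b) : PathHomotopic p p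
  | symm {a b : V} {p q : Path a b} : PathHomotopic p q → PathHomotopic q p
  | trans {a b : V} {p q r : Path a b} :
      PathHomotopic p q → PathHomotopic q r → PathHomotopic p r
  | cancel {a b c d : V} (p : Path a b) (e : b ⟶ c) (q : Path b d) :
      PathHomotopic ((p.comp (e.toPath.comp (reverse e).toPath)).comp q) (p.comp q)

theorem PathHomotopic.comp_left {a b c : V} (r : Path a b) {p q : Path b c}
    (h : PathHomotopic p q) : PathHomotopic (r.comp p) (r.comp q) := by
  induction h with
  | refl p => exact .refl _
  | symm _ ih => exact ih.symm
  | trans _ _ ih₁ ih₂ => exact ih₁.trans ih₂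
  | cancel p e q =>
    simpa only [Path.comp_assoc] using PathHomotopic.cancel (r.comp p) e q

theorem PathHomotopic.comp_right {a b c : V} {p q : Path a b} (r : Path b c)
    (h : PathHomotopic p q) : PathHomotopic (p.comp r) (q.comp r) := by
  induction h with
  | refl p => exact .refl _
  | symm _ ih => exact (ih r).symm
  | trans _ _ ih₁ ih₂ => exact (ih₁ r).trans (ih₂ r)
  | cancel p e q =>
    simpa only [Path.comp_assoc] using PathHomotopic.cancel p e (q.comp r)

theorem PathHomotopic.comp {a b c : V} {p p' : Path a b} {q q' : Path b c}
    (h₁ : PathHomotopic p p') (h₂ : PathHomotopic q q') :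
    PathHomotopic (p.comp q) (p'.comp q') :=
  (h₁.comp_right q).trans (h₂.comp_left p')

theorem PathHomotopic.reverse {a b : V} {p q : Path a b} (h : PathHomotopic p q) :
    PathHomotopic p.reverse q.reverse := by
  induction h with
  | refl p => exact .refl _
  | symm _ ih => exact ih.symm
  | trans _ _ ih₁ ih₂ => exact ih₁.trans ih₂
  | cancel p e q =>
    simpa only [Path.reverse_comp, Path.reverse_toPath, Quiver.reverse_reverse,
      Path.comp_assoc] using PathHomotopic.cancel q.reverse e p.reverse

theorem PathHomotopic.reverse_comp_self {a b : V} (p : Path a b) :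
    PathHomotopic (p.reverse.comp p) Path.nil := by
  induction p with
  | nil => exact .refl _
  | cons p e ih =>
    have h₁ := (ih.comp_left (Quiver.reverse e).toPath).comp_right e.toPath
    have h₂ := PathHomotopic.cancel Path.nil (Quiver.reverse e) Path.nil
    rw [Quiver.reverse_reverse] at h₂
    have h₃ : PathHomotopic (((Quiver.reverse e).toPath.comp (p.reverse.comp p)).comp e.toPath)
        Path.nil := h₁.trans h₂
    rw [← Path.comp_toPath_eq_cons]
    simpa only [Path.reverse_comp, Path.reverse_toPath, Path.comp_assoc] using h₃

/-- Homotopy of the circuits based at `x`. -/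
def homotopySetoid (x : V) : Setoid (Path x x) where
  r := PathHomotopic
  iseqv := ⟨.refl, .symm, .trans⟩

/-- The fundamental group `π₁(Γ, x)` of a graph. -/
def GraphFundamentalGroup (x : V) : Type (max u v) := Quotient (homotopySetoid x)

namespace GraphFundamentalGroup

variable {x : V}

/-- The homotopy class `[p]` of a circuit. -/
def mk (p : Path x x) : GraphFundamentalGroup x := Quotient.mk (homotopySetoid x) p

theorem sound {p q : Path x x} (h : PathHomotopic p q) : mk p = mk q := Quotient.sound h

instance : Group (GraphFundamentalGroup x) where
  one := mk Path.nil
  mul a b := Quotient.liftOn₂ a b (fun p q => mk (p.comp q))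
    (fun _ _ _ _ h₁ h₂ => sound (PathHomotopic.comp h₁ h₂))
  inv a := Quotient.liftOn a (fun p => mk p.reverse)
    (fun _ _ h => sound (PathHomotopic.reverse h))
  mul_assoc := by
    rintro ⟨p⟩ ⟨q⟩ ⟨r⟩
    exact congrArg mk (Path.comp_assoc p q r)
  one_mul := by
    rintro ⟨p⟩
    exact congrArg mk (Path.nil_comp p)
  mul_one := by
    rintro ⟨p⟩
    exact congrArg mk (Path.comp_nil p)
  inv_mul_cancel := by
    rintro ⟨p⟩
    exact sound (PathHomotopic.reverse_comp_self p)

end GraphFundamentalGroup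

end Fundamental

section UniversalCover

variable {U : Type u} [Quiver.{v} U] [HasInvolutiveReverse U]
variable {V : Type u'} [Quiver.{v'} V] [HasInvolutiveReverse V]

theorem PathHomotopic.map (f : U ⥤q V) [f.MapReverse] {a b : U} {p q : Path a b}
    (h : PathHomotopic p q) : PathHomotopic (f.mapPath p) (f.mapPath q) := by
  induction h with
  | refl p => exact .refl _
  | symm _ ih => exact ih.symm
  | trans _ _ ih₁ ih₂ => exact ih₁.trans ih₂
  | cancel p e q =>
    simpa only [Prefunctor.mapPath_comp, Prefunctor.mapPath_toPath, Prefunctor.map_reverse] using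
      PathHomotopic.cancel (f.mapPath p) (f.map e) (f.mapPath q)

/-- The homomorphism `π₁(U, x) → π₁(V, f x)` induced by a graph morphism. -/
def fundamentalGroupMap (f : U ⥤q V) [f.MapReverse] (x : U) :
    GraphFundamentalGroup x →* GraphFundamentalGroup (f.obj x) where
  toFun := Quotient.lift (fun p : Path x x => GraphFundamentalGroup.mk (f.mapPath p))
    (fun _ _ h => GraphFundamentalGroup.sound (PathHomotopic.map f h))
  map_one' := rfl
  map_mul' := by
    rintro ⟨p⟩ ⟨q⟩
    exact congrArg GraphFundamentalGroup.mk (Prefunctor.mapPath_comp f p q)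

/-- The universal cover is the (connected) cover that corresponds to the trivial subgroup of the
fundamental group: `f(π₁(U, x))` is trivial. -/
def IsUniversalCover (f : U ⥤q V) [f.MapReverse] : Prop :=
  IsCover f ∧ ∀ x : U, (fundamentalGroupMap f x).range = ⊥

end UniversalCover

/-! ### Edge labellings and Dyck words -/

/-- A labelling of the edges of a graph over `X ∪ X⁻¹`. The letter `x` is `(x, true)` and `x⁻¹` is
`(x, false)`; the positively oriented edges are those with a label in `X`. Inverse edges have
inverse labels, and edges with the same initial vertex have different labels. (For inverse labels
this also says that positively oriented edges with the same terminal vertex have different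
labels, so that the labelling amounts to an immersion into the bouquet of circles on `X`.) -/
structure EdgeLabelling (V : Type u) [Quiver.{v} V] [HasInvolutiveReverse V] (X : Type w) where
  label : ∀ {a b : V}, (a ⟶ b) → X × Bool
  label_reverse : ∀ {a b : V} (e : a ⟶ b), label (reverse e) = ((label e).1, !(label e).2)
  label_injective : ∀ {a b c : V} (e : a ⟶ b) (e' : a ⟶ c),
    label e = label e' → Quiver.Star.mk e = Quiver.Star.mk e'

/-- A Dyck word over `X ∪ X⁻¹` is a word whose reduced form in the free group is `1`. -/
def IsDyckLabel {X : Type w} (l : List (X × Bool)) : Prop := FreeGroup.mk l = 1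

namespace EdgeLabelling

variable {V : Type u} [Quiver.{v} V] [HasInvolutiveReverse V] {X : Type w}

/-- The label of a path: the word of the labels of its edges. -/
def word (l : EdgeLabelling V X) {a : V} : ∀ {b : V}, Path a b → List (X × Bool)
  | _, Path.nil => []
  | _, Path.cons p e => word l p ++ [l.label e]

theorem word_comp (l : EdgeLabelling V X) {a b c : V} (p : Path a b) (q : Path b c) :
    l.word (p.comp q) = l.word p ++ l.word q := by
  induction q with
  | nil => simp [word]
  | cons q e ih => simp [word, ih]

theorem mk_word_reverse (l : EdgeLabelling V X) {a b : V} (p : Path a b) :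
    FreeGroup.mk (l.word p.reverse) = (FreeGroup.mk (l.word p))⁻¹ := by
  induction p with
  | nil => rfl
  | cons p e ih =>
    have h : l.word (reverse e).toPath = [((l.label e).1, !(l.label e).2)] := by
      simp [Hom.toPath, word, l.label_reverse]
    rw [Path.reverse, word_comp, ← FreeGroup.mul_mk, ih, h, word, ← FreeGroup.mul_mk,
      mul_inv_rev, FreeGroup.inv_mk (L := [l.label e])]
    rfl

theorem mk_word_eq (l : EdgeLabelling V X) {a b : V} {p q : Path a b} (h : InvEquiv p q) :
    FreeGroup.mk (l.word p) = FreeGroup.mk (l.word q) := by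
  induction h with
  | refl p => rfl
  | symm _ ih => exact ih.symm
  | trans _ _ ih₁ ih₂ => exact ih₁.trans ih₂
  | comp _ _ ih₁ ih₂ => simp only [word_comp, ← FreeGroup.mul_mk, ih₁, ih₂]
  | regular p => simp only [word_comp, ← FreeGroup.mul_mk, mk_word_reverse]; group
  | commute p q => simp only [word_comp, ← FreeGroup.mul_mk, mk_word_reverse]; group

/-- An element `[[p]]` of the loop monoid whose label `ℓ(p)` is a Dyck word (this does not depend
on the representative `p`). -/
def IsDyckLoop (l : EdgeLabelling V X) {x : V} : LoopMonoid x → Prop :=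
  Quotient.lift (fun p : Path x x => IsDyckLabel (l.word p))
    (fun _ _ h => by
      have h' := l.mk_word_eq h
      simp only [IsDyckLabel, h'])

end EdgeLabelling

/-! For an immersion, a path of `V` has at most one lift from a given vertex, so paths act on the
vertices of `U` by partial injections: `LiftsTo f p x y` says that `p` sends `x` to `y`. Inverse
paths act by inverse partial injections, hence the action depends only on the `∼ᵢ`-class
(`LiftsTo.iff_of_invEquiv`), and `loopImage f x₀` is the stabilizer of `x₀` (`mk_mem_loopImage`).

(a) A path `p` acts at `x₀` iff `p p⁻¹` fixes `x₀`, and every idempotent has the form `a a⁻¹`. So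
fullness means that all paths from `f x₀` lift at `x₀`, which by connectedness is the covering
property.

(b) Deck transformations commute with the action, so a normal cover has the same stabilizer at all
points of a fibre, and conjugation preserves it. Conversely, if everything normalizes the
stabilizer, it is full, stabilizers agree along each fibre, and transporting lifts from `x` to `y`
defines a deck transformation.

(c) A circuit is idempotent iff it is null-homotopic. One direction holds because `∼ᵢ` refines
homotopy and a group has one idempotent. For the other, a null-homotopic circuit has a Dyck label;
undoing a free reduction inserts some `e e⁻¹`, which multiplies an idempotent by a commuting
idempotent (`LoopMonoid.idem_insert`). The same argument gives the statement on Dyck words. -/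

/-! ### Lifting paths along a graph morphism. -/

section Lifting

variable {U : Type u} [Quiver.{v} U] {V : Type u'} [Quiver.{v'} V]

/-- An edge bundled with its endpoints. -/
def bundledEdge {a b : V} (e : a ⟶ b) : Σ a b : V, a ⟶ b := ⟨a, b, e⟩

theorem bundledEdge_injective {a b : V} {e e' : a ⟶ b} (h : bundledEdge e = bundledEdge e') :
    e = e' := by
  simpa [bundledEdge] using h

theorem bundledEdge_src {a b c d : V} {e : a ⟶ b} {e' : c ⟶ d}
    (h : bundledEdge e = bundledEdge e') : a = c := congrArg Sigma.fst h

theorem bundledEdge_tgt {a b c d : V} {e : a ⟶ b} {e' : c ⟶ d}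
    (h : bundledEdge e = bundledEdge e') : b = d :=
  congrArg (fun t : Σ a b : V, a ⟶ b => t.2.1) h

theorem bundledEdge_map (f : U ⥤q V) {a b c d : U} {e : a ⟶ b} {e' : c ⟶ d}
    (h : bundledEdge e = bundledEdge e') : bundledEdge (f.map e) = bundledEdge (f.map e') :=
  congrArg (fun t : Σ a b : U, a ⟶ b => bundledEdge (f.map t.2.2)) h

theorem bundledEdge_reverse [HasInvolutiveReverse V] {a b c d : V} {e : a ⟶ b} {e' : c ⟶ d}
    (h : bundledEdge e = bundledEdge e') : bundledEdge (reverse e) = bundledEdge (reverse e') :=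
  congrArg (fun t : Σ a b : V, a ⟶ b => bundledEdge (reverse t.2.2)) h

/-- Comparing edges together with their endpoints avoids transport along equalities of vertices. -/
theorem prefunctor_ext {F G : U ⥤q V} (h₀ : ∀ a, F.obj a = G.obj a)
    (h : ∀ {a b : U} (e : a ⟶ b), bundledEdge (F.map e) = bundledEdge (G.map e)) : F = G := by
  obtain ⟨Fo, Fm⟩ := F
  obtain ⟨Go, Gm⟩ := G
  obtain rfl : Fo = Go := funext h₀
  congr 1
  funext a b e
  exact bundledEdge_injective (h e)

theorem IsImmersion.bundledEdge_eq {f : U ⥤q V} (hf : IsImmersion f) {a b b' : U}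
    {e : a ⟶ b} {e' : a ⟶ b'} (h : bundledEdge (f.map e) = bundledEdge (f.map e')) :
    bundledEdge e = bundledEdge e' := by
  have h' : Quiver.Star.mk e = Quiver.Star.mk e' := by
    apply hf a
    simpa [bundledEdge, Prefunctor.star, Quiver.Star.mk] using h
  exact congrArg (fun s : Quiver.Star a => bundledEdge s.2) h'

/-- A quiver morphism obeys no composition law, so the edges over `g` may be chosen independently.
-/
theorem exists_prefunctor_comp_eq {f : U ⥤q V} (g : U → U) (hg : ∀ z, f.obj (g z) = f.obj z)
    (h : ∀ {z z' : U} (e : z ⟶ z'),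
      ∃ e' : g z ⟶ g z', bundledEdge (f.map e') = bundledEdge (f.map e)) :
    ∃ G : U ⥤q U, G.obj = g ∧ G ⋙q f = f := by
  choose m hm using @h
  exact ⟨⟨g, m⟩, rfl, prefunctor_ext hg hm⟩

theorem bundledEdge_map_of_comp_eq {f : U ⥤q V} {F : U ⥤q U} (hF : F ⋙q f = f) {a b : U} (e : a ⟶ b) :
    bundledEdge (f.map (F.map e)) = bundledEdge (f.map e) :=
  congrArg (fun G : U ⥤q V => bundledEdge (G.map e)) hF

theorem IsImmersion.prefunctor_comp_eq_id {f : U ⥤q V} (hf : IsImmersion f) {F G : U ⥤q U}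
    (hF : F ⋙q f = f) (hG : G ⋙q f = f) (h : ∀ z, G.obj (F.obj z) = z) : F ⋙q G = 𝟭q U := by
  refine prefunctor_ext h fun {a b} e => ?_
  have key : bundledEdge (f.map (G.map (F.map e))) = bundledEdge (f.map e) :=
    (bundledEdge_map_of_comp_eq hG _).trans (bundledEdge_map_of_comp_eq hF _)
  change bundledEdge (G.map (F.map e)) = bundledEdge e
  -- Only for an arbitrary edge can its source `G (F a)` be rewritten to `a`.
  generalize G.map (F.map e) = e' at key
  revert e'
  rw [h a]
  exact fun e' he' => hf.bundledEdge_eq he'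

/-- The path `p` lifts along `f` to a path from `x` to `y`. -/
def LiftsTo (f : U ⥤q V) {a : V} : ∀ {b : V}, Path a b → U → U → Prop
  | _, Path.nil, x, y => f.obj x = a ∧ x = y
  | _, Path.cons p e, x, z =>
    ∃ y, LiftsTo f p x y ∧ ∃ e' : y ⟶ z, bundledEdge (f.map e') = bundledEdge e

namespace LiftsTo

variable {f : U ⥤q V} {a b c : V} {x y z : U}

theorem src {p : Path a b} (h : LiftsTo f p x y) : f.obj x = a := by
  induction p generalizing y with
  | nil => exact h.1
  | cons p e ih =>
    obtain ⟨w, hw, -⟩ := h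
    exact ih hw

theorem tgt {p : Path a b} (h : LiftsTo f p x y) : f.obj y = b := by
  cases p with
  | nil => exact h.2 ▸ h.1
  | cons p e =>
    obtain ⟨w, -, e', he⟩ := h
    exact bundledEdge_tgt he

theorem comp_iff {p : Path a b} {q : Path b c} :
    LiftsTo f (p.comp q) x z ↔ ∃ y, LiftsTo f p x y ∧ LiftsTo f q y z := by
  induction q generalizing z with
  | nil =>
    constructor
    · exact fun h => ⟨z, h, h.tgt, rfl⟩
    · rintro ⟨y, h, -, rfl⟩
      exact h
  | cons q e ih =>
    constructor
    · rintro ⟨w, hw, he⟩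
      obtain ⟨y, hy, hq⟩ := ih.1 hw
      exact ⟨y, hy, w, hq, he⟩
    · rintro ⟨y, hy, w, hq, he⟩
      exact ⟨w, ih.2 ⟨y, hy, hq⟩, he⟩

theorem toPath_iff {e : a ⟶ b} :
    LiftsTo f e.toPath x y ↔ ∃ e' : x ⟶ y, bundledEdge (f.map e') = bundledEdge e := by
  constructor
  · rintro ⟨w, ⟨-, rfl⟩, he⟩
    exact he
  · rintro ⟨e', he⟩
    exact ⟨x, ⟨bundledEdge_src he, rfl⟩, e', he⟩

theorem mapPath (p : Path x y) : LiftsTo f (f.mapPath p) x y := by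
  induction p with
  | nil => exact ⟨rfl, rfl⟩
  | cons p e ih => exact ⟨_, ih, e, rfl⟩

/-- The endpoints of `p` are images of `x` and `y` only up to a proved equality, hence the sigma
type. -/
theorem exists_path {p : Path a b} (h : LiftsTo f p x y) :
    ∃ q : Path x y, (⟨_, _, f.mapPath q⟩ : Σ a b : V, Path a b) = ⟨a, b, p⟩ := by
  induction p generalizing y with
  | nil =>
    obtain ⟨rfl, rfl⟩ := h
    exact ⟨Path.nil, rfl⟩
  | cons p e ih =>
    obtain ⟨w, hw, e', he⟩ := h
    obtain ⟨q, hq⟩ := ih hw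
    obtain rfl := hw.src
    obtain rfl := hw.tgt
    obtain rfl := bundledEdge_tgt he
    obtain rfl := bundledEdge_injective he
    refine ⟨q.cons e', ?_⟩
    have hq' : f.mapPath q = p := by simpa using hq
    rw [← hq']
    rfl

theorem exists_mapPath_eq {p : Path (f.obj x) (f.obj y)} (h : LiftsTo f p x y) :
    ∃ q : Path x y, f.mapPath q = p := by
  obtain ⟨q, hq⟩ := h.exists_path
  exact ⟨q, by simpa using hq⟩

theorem unique (hf : IsImmersion f) {p : Path a b} (h : LiftsTo f p x y)
    (h' : LiftsTo f p x z) : y = z := by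
  induction p generalizing y z with
  | nil => exact h.2.symm.trans h'.2
  | cons p e ih =>
    obtain ⟨w, hw, e₁, h₁⟩ := h
    obtain ⟨w', hw', e₂, h₂⟩ := h'
    obtain rfl := ih hw hw'
    exact bundledEdge_tgt (hf.bundledEdge_eq (h₁.trans h₂.symm))

theorem exists_of_isCover (hf : IsCover f) (p : Path a b) (hx : f.obj x = a) :
    ∃ y, LiftsTo f p x y := by
  induction p with
  | nil => exact ⟨x, hx, rfl⟩
  | cons p e ih =>
    obtain ⟨y, hy⟩ := ih
    obtain rfl := hy.tgt
    obtain ⟨⟨z, e'⟩, he⟩ := (hf y).2 (Quiver.Star.mk e)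
    exact ⟨z, y, hy, e', congrArg (fun s : Quiver.Star (f.obj y) => bundledEdge s.2) he⟩

theorem map_of_comp_eq {g : U ⥤q U} (hg : g ⋙q f = f) {p : Path a b} (h : LiftsTo f p x y) :
    LiftsTo f p (g.obj x) (g.obj y) := by
  induction p generalizing y with
  | nil =>
    obtain ⟨h₁, rfl⟩ := h
    exact ⟨(Prefunctor.congr_obj hg x).trans h₁, rfl⟩
  | cons p e ih =>
    obtain ⟨w, hw, e', he⟩ := h
    refine ⟨g.obj w, ih hw, g.map e', Eq.trans ?_ he⟩
    exact congrArg (fun F : U ⥤q V => bundledEdge (F.map e')) hg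

end LiftsTo

end Lifting

/-! ### Lifts and inverse paths; the image as a stabilizer; covers. -/

section LiftingReverse

variable {U : Type u} [Quiver.{v} U] [HasInvolutiveReverse U]
variable {V : Type u'} [Quiver.{v'} V] [HasInvolutiveReverse V]
variable {f : U ⥤q V} [f.MapReverse]

namespace LiftsTo

variable {a b c : V} {x y z : U}

theorem reverse {p : Path a b} (h : LiftsTo f p x y) : LiftsTo f p.reverse y x := by
  induction p generalizing y with
  | nil =>
    obtain ⟨h₁, rfl⟩ := h
    exact ⟨h₁, rfl⟩
  | cons p e ih =>
    obtain ⟨w, hw, e', he⟩ := h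
    refine comp_iff.2 ⟨w, toPath_iff.2 ⟨Quiver.reverse e', ?_⟩, ih hw⟩
    rw [Prefunctor.map_reverse]
    exact bundledEdge_reverse he

theorem reverse_iff {p : Path a b} : LiftsTo f p.reverse y x ↔ LiftsTo f p x y :=
  ⟨fun h => by simpa only [Path.reverse_reverse] using h.reverse, reverse⟩

/-- `p p⁻¹` acts as the identity on the domain of `p`. -/
theorem comp_reverse_iff (hf : IsImmersion f) {p : Path a b} :
    LiftsTo f (p.comp p.reverse) x y ↔ x = y ∧ ∃ z, LiftsTo f p x z := by
  constructor
  · intro h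
    obtain ⟨z, hz, hz'⟩ := comp_iff.1 h
    exact ⟨hz.reverse.unique hf hz', z, hz⟩
  · rintro ⟨rfl, z, hz⟩
    exact comp_iff.2 ⟨z, hz, hz.reverse⟩

/-- Both generating relations hold for partial injections: `p p⁻¹` is a partial identity, and
partial identities commute. -/
theorem iff_of_invEquiv (hf : IsImmersion f) {p q : Path a b} (h : InvEquiv p q) :
    LiftsTo f p x y ↔ LiftsTo f q x y := by
  induction h generalizing x y with
  | refl p => rfl
  | symm _ ih => exact ih.symm
  | trans _ _ ih₁ ih₂ => exact ih₁.trans ih₂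
  | comp _ _ ih₁ ih₂ => simp only [comp_iff, ih₁, ih₂]
  | regular p =>
    rw [comp_iff]
    simp only [comp_reverse_iff hf]
    constructor
    · exact fun h => ⟨x, ⟨rfl, y, h⟩, h⟩
    · rintro ⟨_, ⟨rfl, -⟩, h⟩
      exact h
  | commute p q =>
    rw [comp_iff, comp_iff]
    simp only [comp_reverse_iff hf]
    constructor
    · rintro ⟨_, ⟨rfl, hp⟩, rfl, hq⟩
      exact ⟨_, ⟨rfl, hq⟩, rfl, hp⟩
    · rintro ⟨_, ⟨rfl, hp⟩, rfl, hq⟩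
      exact ⟨_, ⟨rfl, hq⟩, rfl, hp⟩

end LiftsTo

theorem mk_mem_loopImage (hf : IsImmersion f) {x : U} {p : Path (f.obj x) (f.obj x)} :
    LoopMonoid.mk p ∈ loopImage f x ↔ LiftsTo f p x x := by
  constructor
  · rintro ⟨⟨q⟩, hq⟩
    have h : InvEquiv (f.mapPath q) p := Quotient.exact hq
    exact (LiftsTo.iff_of_invEquiv hf h).1 (LiftsTo.mapPath q)
  · intro h
    obtain ⟨q, rfl⟩ := h.exists_mapPath_eq
    exact ⟨LoopMonoid.mk q, rfl⟩

theorem loopImage_inv_mem (x : U) {h : LoopMonoid (f.obj x)} (hh : h ∈ loopImage f x) :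
    h⁻¹ ∈ loopImage f x := by
  obtain ⟨⟨q⟩, rfl⟩ := hh
  refine ⟨LoopMonoid.mk q.reverse, ?_⟩
  exact congrArg LoopMonoid.mk (mapPath_reverse f q)

theorem IsImmersion.isFull_iff (hf : IsImmersion f) {x : U} :
    InverseMonoid.IsFull (loopImage f x) ↔
      ∀ {b : V} (p : Path (f.obj x) b), ∃ y, LiftsTo f p x y := by
  constructor
  · intro h b p
    -- Although `p` need not be closed, `p p⁻¹` is an idempotent circuit.
    have hm : LoopMonoid.mk (p.comp p.reverse) ∈ loopImage f x := h.2 <| by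
      change LoopMonoid.mk _ * LoopMonoid.mk _ = _
      rw [LoopMonoid.mk_mul, ← Path.comp_assoc]
      exact LoopMonoid.sound ((InvEquiv.regular p).symm.comp (.refl _))
    exact ((LiftsTo.comp_reverse_iff hf).1 ((mk_mem_loopImage hf).1 hm)).2
  · refine fun h => ⟨fun _ => loopImage_inv_mem x, ?_⟩
    intro e he
    rw [LoopMonoid.eq_mul_inv_of_idem he]
    obtain ⟨p⟩ := e
    exact (mk_mem_loopImage hf).2 ((LiftsTo.comp_reverse_iff hf).2 ⟨rfl, h p⟩)

theorem IsImmersion.isCover_iff_isFull (hU : IsStronglyConnected U) (hf : IsImmersion f)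
    (x₀ : U) : IsCover f ↔ InverseMonoid.IsFull (loopImage f x₀) := by
  rw [hf.isFull_iff]
  constructor
  · exact fun h b p => LiftsTo.exists_of_isCover h p rfl
  · refine fun h x => ⟨hf x, ?_⟩
    rintro ⟨w, e⟩
    obtain ⟨r⟩ := hU x₀ x
    -- An edge at `f x` is tested from `x₀` by prepending the image of `r`; uniqueness makes the
    -- lift pass through `x`.
    obtain ⟨z, y, hy, e', he⟩ := h ((f.mapPath r).cons e)
    obtain rfl := (LiftsTo.mapPath r).unique hf hy
    obtain rfl := bundledEdge_tgt he
    exact ⟨Quiver.Star.mk e', congrArg Quiver.Star.mk (bundledEdge_injective he)⟩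

/-! ### Deck transformations -/

theorem IsImmersion.mapReverse_of_comp_eq (hf : IsImmersion f) {F : U ⥤q U}
    (hF : F ⋙q f = f) : F.MapReverse where
  map_reverse' {a b} e := by
    apply bundledEdge_injective
    apply hf.bundledEdge_eq
    rw [bundledEdge_map_of_comp_eq hF, Prefunctor.map_reverse, Prefunctor.map_reverse]
    exact (bundledEdge_reverse (bundledEdge_map_of_comp_eq hF e)).symm

/-- `G z` is the end of the lift at `y` of any path whose lift at `x` ends at `z`; `h` makes this
independent of the path. -/
theorem IsCover.exists_prefunctor (hU : IsStronglyConnected U) (hf : IsCover f) {x y : U}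
    (hxy : f.obj x = f.obj y)
    (h : ∀ {a : V} (c : Path a a), LiftsTo f c x x → LiftsTo f c y y) :
    ∃ G : U ⥤q U, G ⋙q f = f ∧ ∀ {b : V} (p : Path (f.obj x) b) {z w : U},
      LiftsTo f p x z → LiftsTo f p y w → G.obj z = w := by
  have hi : IsImmersion f := fun z => (hf z).1
  have ex : ∀ z, ∃ w, ∃ p : Path (f.obj x) (f.obj z), LiftsTo f p x z ∧ LiftsTo f p y w := by
    intro z
    obtain ⟨r⟩ := hU x z
    obtain ⟨w, hw⟩ := LiftsTo.exists_of_isCover hf (f.mapPath r) hxy.symm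
    exact ⟨w, _, LiftsTo.mapPath r, hw⟩
  choose g p hp hpg using ex
  have hg : ∀ {b : V} (q : Path (f.obj x) b) {z w : U},
      LiftsTo f q x z → LiftsTo f q y w → g z = w := by
    intro b q z w hz hw
    obtain rfl := hz.tgt
    obtain ⟨w', h₁, h₂⟩ := LiftsTo.comp_iff.1
      (h ((p z).comp q.reverse) (LiftsTo.comp_iff.2 ⟨z, hp z, hz.reverse⟩))
    exact ((hpg z).unique hi h₁).trans ((LiftsTo.reverse_iff.1 h₂).unique hi hw)
  obtain ⟨G, rfl, hG⟩ := exists_prefunctor_comp_eq (f := f) g (fun z => (hpg z).tgt)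
    (fun {z z'} e => by
      -- The last edge of this lift runs from `g z` to `g z'` and is the required image of `e`.
      obtain ⟨w, hw⟩ := LiftsTo.exists_of_isCover hf ((p z).cons (f.map e)) hxy.symm
      obtain rfl := hg ((p z).cons (f.map e)) (z := z') ⟨z, hp z, e, rfl⟩ hw
      obtain ⟨w', hw', he⟩ := hw
      obtain rfl := (hpg z).unique hi hw'
      exact he)
  exact ⟨G, hG, hg⟩

theorem IsCover.exists_deckTransformation (hU : IsStronglyConnected U) (hf : IsCover f) {x y : U}
    (hxy : f.obj x = f.obj y)
    (h : ∀ {a : V} (c : Path a a), LiftsTo f c x x ↔ LiftsTo f c y y) :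
    ∃ γ : DeckTransformation f, γ.hom.obj x = y := by
  have hi : IsImmersion f := fun z => (hf z).1
  obtain ⟨F, hF, hF'⟩ := hf.exists_prefunctor hU hxy fun c => (h c).1
  obtain ⟨G, hG, hG'⟩ := hf.exists_prefunctor hU hxy.symm fun c => (h c).2
  have hx : F.obj x = y := hF' Path.nil ⟨rfl, rfl⟩ ⟨hxy.symm, rfl⟩
  have hy : G.obj y = x := hG' Path.nil ⟨rfl, rfl⟩ ⟨hxy, rfl⟩
  -- The composite lies over `f` and fixes `x`, so unique lifting makes it fix every vertex.
  have hGF : ∀ z, G.obj (F.obj z) = z := fun z => by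
    obtain ⟨r⟩ := hU x z
    have h₁ := (LiftsTo.mapPath (f := f) r).map_of_comp_eq hF
    have h₂ := h₁.map_of_comp_eq hG
    rw [hx, hy] at h₂
    exact h₂.unique hi (LiftsTo.mapPath r)
  have hFG : ∀ z, F.obj (G.obj z) = z := fun z => by
    obtain ⟨r⟩ := hU y z
    have h₁ := (LiftsTo.mapPath (f := f) r).map_of_comp_eq hG
    have h₂ := h₁.map_of_comp_eq hF
    rw [hy, hx] at h₂
    exact h₂.unique hi (LiftsTo.mapPath r)
  exact ⟨⟨F, G, hi.prefunctor_comp_eq_id hF hG hGF, hi.prefunctor_comp_eq_id hG hF hFG,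
    hi.mapReverse_of_comp_eq hF, hF⟩, hx⟩

theorem IsNormalCover.conj_mem (hf : IsNormalCover f) {x₀ : U} (a : LoopMonoid (f.obj x₀))
    {h : LoopMonoid (f.obj x₀)} (hh : h ∈ loopImage f x₀) : a * h * a⁻¹ ∈ loopImage f x₀ := by
  have hi : IsImmersion f := fun z => (hf.1 z).1
  obtain ⟨p⟩ := a
  obtain ⟨c⟩ := h
  obtain ⟨y, hy⟩ := LiftsTo.exists_of_isCover hf.1 p (rfl : f.obj x₀ = _)
  obtain ⟨γ, rfl⟩ := hf.2 x₀ y hy.tgt.symm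
  have hc : LiftsTo f c x₀ x₀ := (mk_mem_loopImage hi).1 hh
  exact (mk_mem_loopImage hi (p := (p.comp c).comp p.reverse)).2 <| LiftsTo.comp_iff.2
    ⟨_, LiftsTo.comp_iff.2 ⟨_, hy, hc.map_of_comp_eq γ.comp_eq⟩, hy.reverse⟩

/-- For an idempotent `e`, conjugating `1` gives `e 1 e⁻¹ = e`. -/
theorem isFull_of_normalizer_eq_univ {x₀ : U}
    (h : InverseMonoid.normalizer (loopImage f x₀) = Set.univ) :
    InverseMonoid.IsFull (loopImage f x₀) := by
  refine ⟨fun _ => loopImage_inv_mem x₀, fun e he => ?_⟩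
  have ha : e ∈ InverseMonoid.normalizer (loopImage f x₀) := h ▸ Set.mem_univ e
  have h₁ := ha.1 1 (one_mem _)
  rw [mul_one, ← LoopMonoid.eq_mul_inv_of_idem he] at h₁
  exact h₁

/-- With `p` leading from `x₀` to `x`, the circuit `p c p⁻¹` fixes `x₀`. A circuit `k` sending `x₀`
to a point `x'` from which `p` leads to `y` normalizes the stabilizer, so `p c p⁻¹` also fixes `x'`,
and `c` fixes `y`. -/
theorem IsCover.liftsTo_of_normalizer_eq_univ (hU : IsStronglyConnected U) (hf : IsCover f)
    {x₀ : U} (hN : InverseMonoid.normalizer (loopImage f x₀) = Set.univ) {x y : U}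
    (hxy : f.obj x = f.obj y) {a : V} (c : Path a a) (hc : LiftsTo f c x x) :
    LiftsTo f c y y := by
  have hi : IsImmersion f := fun z => (hf z).1
  obtain rfl := hc.src
  obtain ⟨r⟩ := hU x₀ x
  have hs : ∃ s : Path (f.obj x) (f.obj y), LiftsTo f s x y :=
    (hU x y).elim fun s => ⟨_, LiftsTo.mapPath s⟩
  -- This makes `s` a circuit at `f x`, so that `p s p⁻¹` can be formed.
  rw [← hxy] at hs
  obtain ⟨s, hs⟩ := hs
  have hr := LiftsTo.mapPath (f := f) r
  obtain ⟨x', hx'⟩ := LiftsTo.exists_of_isCover hf (f.mapPath r).reverse hxy.symm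
  generalize f.mapPath r = p at hr hx'
  have hk : LiftsTo f ((p.comp s).comp p.reverse) x₀ x' :=
    LiftsTo.comp_iff.2 ⟨y, LiftsTo.comp_iff.2 ⟨x, hr, hs⟩, hx'⟩
  have hc' : LiftsTo f ((p.comp c).comp p.reverse) x₀ x₀ :=
    LiftsTo.comp_iff.2 ⟨x, LiftsTo.comp_iff.2 ⟨x, hr, hc⟩, hr.reverse⟩
  generalize (p.comp s).comp p.reverse = k at hk
  have hm : LoopMonoid.mk k ∈ InverseMonoid.normalizer (loopImage f x₀) := hN ▸ Set.mem_univ _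
  have h₁ := (mk_mem_loopImage hi (p := (k.comp ((p.comp c).comp p.reverse)).comp k.reverse)).1
    (hm.1 _ ((mk_mem_loopImage hi).2 hc'))
  -- The lift of `k p c p⁻¹ k⁻¹` at `x₀` is cut into pieces; uniqueness identifies the intermediate
  -- vertices as `x'` and `y`.
  obtain ⟨z, h₂, h₃⟩ := LiftsTo.comp_iff.1 h₁
  obtain ⟨z', h₄, h₅⟩ := LiftsTo.comp_iff.1 h₂
  obtain rfl := hk.unique hi (LiftsTo.reverse_iff.1 h₃)
  obtain rfl := hk.unique hi h₄
  obtain ⟨w, h₆, h₇⟩ := LiftsTo.comp_iff.1 h₅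
  obtain ⟨w', h₈, h₉⟩ := LiftsTo.comp_iff.1 h₆
  have hp := LiftsTo.reverse_iff.1 hx'
  obtain rfl := hp.unique hi h₈
  obtain rfl := hp.unique hi (LiftsTo.reverse_iff.1 h₇)
  exact h₉

theorem IsImmersion.isNormalCover_iff (hU : IsStronglyConnected U) (hf : IsImmersion f)
    (x₀ : U) :
    IsNormalCover f ↔ InverseMonoid.normalizer (loopImage f x₀) = Set.univ := by
  constructor
  · refine fun h => Set.eq_univ_of_forall fun a => ⟨fun _ hh => h.conj_mem a hh, fun k hk => ?_⟩
    simpa only [LoopMonoid.inv_inv'] using h.conj_mem a⁻¹ hk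
  · intro h
    have hc : IsCover f := (hf.isCover_iff_isFull hU x₀).2 (isFull_of_normalizer_eq_univ h)
    exact ⟨hc, fun x y hxy => hc.exists_deckTransformation hU hxy fun c =>
      ⟨hc.liftsTo_of_normalizer_eq_univ hU h hxy c,
        hc.liftsTo_of_normalizer_eq_univ hU h hxy.symm c⟩⟩

end LiftingReverse

/-! ### Idempotents, Dyck words and null-homotopic circuits -/

section Dyck

variable {V : Type u} [Quiver.{v} V] [HasInvolutiveReverse V]

/-- Write `p` as `p p⁻¹ p` and commute `p⁻¹ p` past `r r⁻¹`. -/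
theorem InvEquiv.insert {a b c d : V} (p : Path a b) (r : Path b c) (q : Path b d) :
    InvEquiv ((p.comp (r.comp r.reverse)).comp q)
      (((p.comp r).comp (p.comp r).reverse).comp (p.comp q)) := by
  have h := (InvEquiv.regular p).comp (InvEquiv.refl ((r.comp r.reverse).comp q))
  have h' := (InvEquiv.commute p.reverse r).comp (InvEquiv.refl q)
  have h'' := (InvEquiv.refl p).comp h'
  simp only [Path.reverse_comp, Path.reverse_reverse, Path.comp_assoc] at h h' h'' ⊢
  exact h.trans h''

theorem LoopMonoid.mk_comp_reverse_idem {x b : V} (p : Path x b) :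
    mk (p.comp p.reverse) * mk (p.comp p.reverse) = mk (p.comp p.reverse) := by
  rw [mk_mul, ← Path.comp_assoc]
  exact sound ((InvEquiv.regular p).symm.comp (.refl _))

/-- By `InvEquiv.insert` the class is a product of two idempotents, and idempotents commute. -/
theorem LoopMonoid.idem_insert {x b c : V} (p : Path x b) (r : Path b c) (q : Path b x)
    (h : mk (p.comp q) * mk (p.comp q) = mk (p.comp q)) :
    mk ((p.comp (r.comp r.reverse)).comp q) * mk ((p.comp (r.comp r.reverse)).comp q) =
      mk ((p.comp (r.comp r.reverse)).comp q) := by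
  rw [sound (InvEquiv.insert p r q), ← mk_mul]
  have hr := mk_comp_reverse_idem (p.comp r)
  generalize mk ((p.comp r).comp (p.comp r).reverse) = e at *
  rw [mul_assoc, ← mul_assoc _ e, ← idem_comm hr h, mul_assoc e, h, ← mul_assoc, hr]

theorem InvEquiv.pathHomotopic {a b : V} {p q : Path a b} (h : InvEquiv p q) :
    PathHomotopic p q := by
  have key : ∀ {a b : V} (p : Path a b), PathHomotopic (p.comp p.reverse) Path.nil :=
    fun p => by simpa only [Path.reverse_reverse] using PathHomotopic.reverse_comp_self p.reverse
  induction h with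
  | refl p => exact .refl _
  | symm _ ih => exact ih.symm
  | trans _ _ ih₁ ih₂ => exact ih₁.trans ih₂
  | comp _ _ ih₁ ih₂ => exact ih₁.comp ih₂
  | regular p => simpa only [Path.nil_comp] using ((key p).comp_right p).symm
  | commute p q => exact ((key p).comp (key q)).trans ((key q).comp (key p)).symm

theorem pathHomotopic_nil_of_idem {x : V} {p : Path x x}
    (h : LoopMonoid.mk p * LoopMonoid.mk p = LoopMonoid.mk p) : PathHomotopic p Path.nil := by
  have h₁ : InvEquiv (p.comp p) p := Quotient.exact h
  have h₂ : GraphFundamentalGroup.mk p * GraphFundamentalGroup.mk p =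
      GraphFundamentalGroup.mk p := GraphFundamentalGroup.sound h₁.pathHomotopic
  exact Quotient.exact (mul_eq_left.1 h₂)

namespace EdgeLabelling

variable {X : Type w} (l : EdgeLabelling V X)

theorem exists_comp_of_word_eq_append {a b : V} (p : Path a b) (L₁ L₂ : List (X × Bool))
    (h : l.word p = L₁ ++ L₂) :
    ∃ (c : V) (p₁ : Path a c) (p₂ : Path c b),
      p = p₁.comp p₂ ∧ l.word p₁ = L₁ ∧ l.word p₂ = L₂ := by
  induction p generalizing L₂ with
  | nil =>
    obtain ⟨rfl, rfl⟩ := List.append_eq_nil_iff.1 h.symm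
    exact ⟨_, Path.nil, Path.nil, rfl, rfl, rfl⟩
  | cons p e ih =>
    rcases L₂.eq_nil_or_concat with rfl | ⟨L, t, rfl⟩
    · exact ⟨_, p.cons e, Path.nil, rfl, by simpa using h, rfl⟩
    · rw [List.concat_eq_append] at h ⊢
      rw [word, ← List.append_assoc] at h
      obtain ⟨h₁, h₂⟩ := List.append_inj' h rfl
      obtain ⟨c, p₁, p₂, rfl, rfl, rfl⟩ := ih L h₁
      exact ⟨c, p₁, p₂.cons e, rfl, rfl, by rw [word, h₂]⟩

theorem exists_toPath_of_word_eq_singleton {a b : V} (p : Path a b) (t : X × Bool)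
    (h : l.word p = [t]) : ∃ e : a ⟶ b, p = e.toPath ∧ l.label e = t := by
  cases p with
  | nil => simp [word] at h
  | cons p e =>
    cases p with
    | nil => exact ⟨e, rfl, by simpa [word] using h⟩
    | cons p e' =>
      have hl := congrArg List.length h
      simp [word] at hl

theorem exists_of_step {a b : V} (p : Path a b) {L : List (X × Bool)}
    (h : FreeGroup.Red.Step (l.word p) L) :
    ∃ (c d : V) (p₁ : Path a c) (e : c ⟶ d) (p₂ : Path c b),
      p = (p₁.comp (e.toPath.comp e.toPath.reverse)).comp p₂ ∧ l.word (p₁.comp p₂) = L := by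
  generalize hw : l.word p = W at h
  obtain @⟨L₁, L₂, x, t⟩ := h
  obtain ⟨c, p₁, q, rfl, rfl, hq⟩ := l.exists_comp_of_word_eq_append p _ _ hw
  obtain ⟨d, q₁, q', rfl, hq₁, hq'⟩ := l.exists_comp_of_word_eq_append q [(x, t)] _ hq
  obtain ⟨c', q₂, p₂, rfl, hq₂, rfl⟩ := l.exists_comp_of_word_eq_append q' [(x, !t)] _ hq'
  obtain ⟨e, rfl, he⟩ := l.exists_toPath_of_word_eq_singleton _ _ hq₁
  obtain ⟨e', rfl, he'⟩ := l.exists_toPath_of_word_eq_singleton _ _ hq₂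
  -- Both edges start at `d` and carry the inverse of the label of `e`.
  have hee : Quiver.Star.mk e' = Quiver.Star.mk (reverse e) :=
    l.label_injective _ _ (by rw [he', l.label_reverse, he])
  obtain rfl : c' = c := congrArg Sigma.fst hee
  obtain rfl : e' = reverse e := by simpa [Quiver.Star.mk] using hee
  exact ⟨c', d, p₁, e, p₂, by simp only [Path.reverse_toPath, Path.comp_assoc],
    l.word_comp p₁ p₂⟩

/-- Induction along a free reduction of the label to the empty word, each step of which deletes some
`e e⁻¹` from the path. -/
theorem idem_of_isDyckLabel {x : V} (p : Path x x) (h : IsDyckLabel (l.word p)) :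
    LoopMonoid.mk p * LoopMonoid.mk p = LoopMonoid.mk p := by
  have hred : FreeGroup.Red (l.word p) [] := by
    obtain ⟨L, h₁, h₂⟩ := FreeGroup.Red.exact.1 (h.trans FreeGroup.one_eq_mk)
    rwa [FreeGroup.Red.nil_iff.1 h₂] at h₁
  generalize hw : l.word p = W at hred
  induction hred using Relation.ReflTransGen.head_induction_on generalizing p with
  | refl =>
    cases p with
    | nil => exact one_mul _
    | cons p e => simp [word] at hw
  | head h₁ _ ih =>
    subst hw
    obtain ⟨c, d, p₁, e, p₂, rfl, hL⟩ := l.exists_of_step p h₁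
    refine LoopMonoid.idem_insert p₁ e.toPath p₂ (ih _ ?_ hL)
    rw [IsDyckLabel, hL, ← h]
    exact (Quot.sound h₁).symm

theorem idempotents_eq (x : V) :
    InverseMonoid.idempotents (LoopMonoid x) = {p : LoopMonoid x | l.IsDyckLoop p} := by
  ext ⟨p⟩
  constructor
  · intro h
    have h' : InvEquiv (p.comp p) p := Quotient.exact h
    have h'' := l.mk_word_eq h'
    rw [word_comp, ← FreeGroup.mul_mk] at h''
    exact mul_eq_left.1 h''
  · exact l.idem_of_isDyckLabel p

/-- This turns null-homotopic circuits into circuits with Dyck labels. -/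
theorem mk_word_eq_of_pathHomotopic {a b : V} {p q : Path a b} (h : PathHomotopic p q) :
    FreeGroup.mk (l.word p) = FreeGroup.mk (l.word q) := by
  induction h with
  | refl p => rfl
  | symm _ ih => exact ih.symm
  | trans _ _ ih₁ ih₂ => exact ih₁.trans ih₂
  | cancel p e q =>
    rw [← Path.reverse_toPath]
    simp only [word_comp, ← FreeGroup.mul_mk, mk_word_reverse]
    group

end EdgeLabelling

/-- Two edges are related if they are equal or inverse to each other. -/
def geometricEdgeSetoid (V : Type u) [Quiver.{v} V] [HasInvolutiveReverse V] :
    Setoid (Σ a b : V, a ⟶ b) where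
  r s t := s = t ∨ s = bundledEdge (reverse t.2.2)
  iseqv :=
    { refl := fun _ => .inl rfl
      symm := by
        rintro s ⟨a, b, e⟩ (rfl | rfl)
        · exact .inl rfl
        · exact .inr (by simp [bundledEdge])
      trans := by
        rintro r s t (rfl | rfl) (rfl | rfl)
        · exact .inl rfl
        · exact .inr rfl
        · exact .inr rfl
        · exact .inl (by simp [bundledEdge]) }

theorem bundledEdge_reverse_ne [IsSerreGraph V] {a b : V} (e : a ⟶ b) :
    bundledEdge (reverse e) ≠ bundledEdge e := by
  intro h
  obtain rfl := bundledEdge_src h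
  exact IsSerreGraph.reverse_ne e (bundledEdge_injective h)

open Classical in
/-- The labelling of the edges by geometric edges, for a choice of orientation. -/
noncomputable def orientationLabelling (V : Type u) [Quiver.{v} V] [HasInvolutiveReverse V] [IsSerreGraph V] :
    EdgeLabelling V (Quotient (geometricEdgeSetoid V)) where
  label e := (Quotient.mk _ (bundledEdge e),
    decide ((Quotient.mk (geometricEdgeSetoid V) (bundledEdge e)).out = bundledEdge e))
  label_reverse {a b} e := by
    have hq : Quotient.mk (geometricEdgeSetoid V) (bundledEdge (reverse e)) =
        Quotient.mk _ (bundledEdge e) := Quotient.sound (.inr rfl)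
    rw [hq]
    -- The representative is `e` or `e⁻¹`, never both because `e⁻¹ ≠ e`; so inversion flips the
    -- sign.
    have ho : (Quotient.mk (geometricEdgeSetoid V) (bundledEdge e)).out = bundledEdge e ∨
        (Quotient.mk (geometricEdgeSetoid V) (bundledEdge e)).out = bundledEdge (reverse e) :=
      Quotient.mk_out (s := geometricEdgeSetoid V) (bundledEdge e)
    rcases ho with ho | ho
    · simp [ho, (bundledEdge_reverse_ne e).symm]
    · simp [ho, bundledEdge_reverse_ne e]
  label_injective {a b c} e e' h := by
    obtain ⟨h₁, h₂⟩ := Prod.ext_iff.1 h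
    have hee : bundledEdge e = bundledEdge e' := by
      have h₂' := decide_eq_decide.1 h₂
      simp only at h₁
      rw [h₁] at h₂'
      have hr : bundledEdge e = bundledEdge e' ∨ bundledEdge e = bundledEdge (reverse e') :=
        Quotient.exact h₁
      have ho : (Quotient.mk (geometricEdgeSetoid V) (bundledEdge e')).out = bundledEdge e' ∨
          (Quotient.mk (geometricEdgeSetoid V) (bundledEdge e')).out = bundledEdge (reverse e') :=
        Quotient.mk_out (s := geometricEdgeSetoid V) (bundledEdge e')
      rcases hr with hr | hr
      · exact hr
      -- If `e = e'⁻¹`, equal signs force the representative to be both `e'` and `e'⁻¹`.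
      · rw [hr] at h₂' ⊢
        rcases ho with ho | ho
        · exact (h₂'.2 ho).symm.trans ho
        · exact ho.symm.trans (h₂'.1 ho)
    simpa [bundledEdge, Quiver.Star.mk] using hee

/-- No labelling is given here; the orientation labelling, available on every Serre graph, reduces
the claim to Dyck words. -/
theorem idem_of_pathHomotopic_nil [IsSerreGraph V] {x : V} {p : Path x x}
    (h : PathHomotopic p Path.nil) : LoopMonoid.mk p * LoopMonoid.mk p = LoopMonoid.mk p :=
  (orientationLabelling V).idem_of_isDyckLabel p
    ((orientationLabelling V).mk_word_eq_of_pathHomotopic h)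

end Dyck

/-! ### The universal cover. -/

section Universal

variable {U : Type u} [Quiver.{v} U] [HasInvolutiveReverse U]
variable {V : Type u'} [Quiver.{v'} V] [HasInvolutiveReverse V]
variable {f : U ⥤q V} [f.MapReverse]

theorem fundamentalGroupMap_range_eq_bot_iff (x : U) :
    (fundamentalGroupMap f x).range = ⊥ ↔
      ∀ q : Path x x, PathHomotopic (f.mapPath q) Path.nil := by
  rw [MonoidHom.range_eq_bot_iff]
  constructor
  · intro h q
    exact Quotient.exact (DFunLike.congr_fun h (GraphFundamentalGroup.mk q))
  · intro h
    ext ⟨q⟩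
    exact GraphFundamentalGroup.sound (h q)

theorem pathHomotopic_nil_of_conj {a b : V} (p : Path a b) (q : Path b b)
    (h : PathHomotopic ((p.comp q).comp p.reverse) Path.nil) : PathHomotopic q Path.nil := by
  have hp := PathHomotopic.reverse_comp_self p
  have h₁ := (h.comp_left p.reverse).comp_right p
  have h₂ : PathHomotopic ((p.reverse.comp p).comp (q.comp (p.reverse.comp p))) q := by
    simpa only [Path.nil_comp, Path.comp_nil] using hp.comp (hp.comp_left q)
  simp only [Path.comp_assoc, Path.comp_nil] at h₁ h₂
  exact h₂.symm.trans (h₁.trans hp)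

theorem IsImmersion.isUniversalCover_iff [IsSerreGraph V] (hU : IsStronglyConnected U)
    (hf : IsImmersion f) (x₀ : U) :
    IsUniversalCover f ↔ (loopImage f x₀ : Set (LoopMonoid (f.obj x₀))) =
      InverseMonoid.idempotents (LoopMonoid (f.obj x₀)) := by
  constructor
  · rintro ⟨hc, ht⟩
    refine Set.Subset.antisymm ?_ ((hf.isCover_iff_isFull hU x₀).1 hc).2
    rintro _ ⟨⟨q⟩, rfl⟩
    exact idem_of_pathHomotopic_nil ((fundamentalGroupMap_range_eq_bot_iff x₀).1 (ht x₀) q)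
  · intro h
    refine ⟨(hf.isCover_iff_isFull hU x₀).2 ⟨fun _ => loopImage_inv_mem x₀, h.ge⟩, fun x => ?_⟩
    rw [fundamentalGroupMap_range_eq_bot_iff]
    intro q
    obtain ⟨r⟩ := hU x₀ x
    -- Conjugating by `r` moves the circuit from `x` to the base point `x₀`, where `h` applies.
    have hm : LoopMonoid.mk (f.mapPath ((r.comp q).comp r.reverse)) ∈
        InverseMonoid.idempotents (LoopMonoid (f.obj x₀)) := h ▸ ⟨LoopMonoid.mk _, rfl⟩
    have hn := pathHomotopic_nil_of_idem hm
    rw [Prefunctor.mapPath_comp, Prefunctor.mapPath_comp, mapPath_reverse] at hn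
    exact pathHomotopic_nil_of_conj _ _ hn

end Universal

theorem mainTheorem3
    {U : Type u} [Quiver.{v} U] [HasInvolutiveReverse U] [IsSerreGraph U]
    {V : Type u'} [Quiver.{v'} V] [HasInvolutiveReverse V] [IsSerreGraph V]
    (hU : IsStronglyConnected U) (hV : IsStronglyConnected V)
    (f : U ⥤q V) [f.MapReverse] (hf : IsImmersion f) (x₀ : U) :
    (IsCover f ↔ InverseMonoid.IsFull (loopImage f x₀)) ∧
    (IsNormalCover f ↔ InverseMonoid.normalizer (loopImage f x₀) = Set.univ) ∧
    (IsUniversalCover f ↔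
      (loopImage f x₀ : Set (LoopMonoid (f.obj x₀))) =
        InverseMonoid.idempotents (LoopMonoid (f.obj x₀))) ∧
    (∀ {X : Type w} (l : EdgeLabelling V X),
      InverseMonoid.idempotents (LoopMonoid (f.obj x₀)) =
        {p : LoopMonoid (f.obj x₀) | l.IsDyckLoop p}) := by
  exact ⟨hf.isCover_iff_isFull hU x₀, hf.isNormalCover_iff hU x₀, hf.isUniversalCover_iff hU x₀,
    fun l => l.idempotents_eq _⟩
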